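/- Let $K=\mathbb R$ or $\mathbb C$. For $K$-vector spaces $E,F$ let $F[E]_m$ be the space of maps $E\to F$ of the form $x\mapsto u(x,\dots,x)$ with $u:E^m\to F$ $m$-linear, and let $F[[E]]=\prod_{m\ge 0}F[E]_m$ be the space of formal series. For $\xi=\sum_r\xi_r\in X[[X]]$ and $f=\sum_m f_m\in F[[X]]$, with $f_m(x)=u_m(x,\dots,x)$, let $\xi.f\in F[[X]]$ be the formal series whose component of degree $s$ is $\sum_{r+m-1=s}\xi_r.f_m$, where $$(\xi_r.f_m)(x)=\sum_{i=1}^m u_m(x,\dots,x,\underbrace{\xi_r(x)}_{i},x,\dots,x)$$ (this does not depend on the choice of $u_m$). The space $S(X)=X[[X]]$ with the bracket $[\xi,\eta]=\xi.\eta-\eta.\xi$ is a Lie algebra. A formal action of a Lie algebra $A$ on $X$ is a homomorphism of Lie algebras $A\to S(X)$. Theorem. Let $A$ be a complete normable Lie algebra over $K$ (a Lie algebra, complete for a norm for which the bracket is continuous), let $X$ be a Banach space over $K$, and let $U$ be an open neighbourhood of $0$ in $X$. Let $a\mapsto\xi_a$ be an analytic infinitesimal right operation law of $A$ on $U$: each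 $\xi_a$ is a vector field on $U$, the map $(a,x)\mapsto\xi_a(x)$ from $A\times U$ to $X$ is analytic and is linear in $a$, and $[\xi_a,\xi_b]=\xi_{[a,b]}$ on $U$ for all $a,b\in A$, where the bracket of vector fields is $[\xi,\eta](x)=\mathrm d_x\eta(\xi(x))-\mathrm d_x\xi(\eta(x))$. Let $h:U\to X$ be the inclusion, let $\xi_a(h)$ be the function $x\mapsto \mathrm d_xh(\xi_a(x))$, and let $D_a\in S(X)$ be its Taylor series at $0$, whose component of degree $m$ is $x\mapsto\frac1{m!}\,\mathrm d^m(\xi_a(h))(0)(x,\dots,x)$; it has continuous components and converges to $\xi_a(h)$ near $0$. Then $a\mapsto D_a$ is a formal action of $A$ on $X$; that is, $D_a$ is linear in $a$ and $D_{[a,b]}=[D_a,D_b]=D_a.D_b-D_b.D_a$ in $S(X)$ for all $a,b\in A$. -/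

import Mathlib

/-- `F[E]_m`: the space of homogeneous polynomials of degree `m` with variables in `E` and
coefficients in `F`, i.e. the maps `x ↦ u (x, …, x)` with `u : E^m → F` multilinear over `K`. -/
def homPoly (K E F : Type*) [Field K] [AddCommGroup E] [Module K E] [AddCommGroup F] [Module K F]
    (m : ℕ) : Submodule K (E → F) where
  carrier := {f | ∃ u : MultilinearMap K (fun _ : Fin m => E) F, ∀ x, f x = u (fun _ => x)}
  zero_mem' := ⟨0, fun _ => rfl⟩
  add_mem' := by
    rintro f g ⟨u, hu⟩ ⟨v, hv⟩
    exact ⟨u + v, fun x => by simp [hu, hv]⟩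
  smul_mem' := by
    rintro c f ⟨u, hu⟩
    exact ⟨c • u, fun x => by simp [hu]⟩

namespace homPoly

section Basic

variable {K E F : Type*} [Field K] [AddCommGroup E] [Module K E] [AddCommGroup F] [Module K F]

/-- Any finite index type with `m` elements may be used in place of `Fin m`. -/
theorem mem_of_card {ι : Type*} [Fintype ι] {m : ℕ} (hm : Fintype.card ι = m) (f : E → F)
    (u : MultilinearMap K (fun _ : ι => E) F) (hu : ∀ x, f x = u (fun _ => x)) :
    f ∈ homPoly K E F m := by
  subst hm
  exact ⟨u.domDomCongr (Fintype.equivFin ι), fun x => by simp [hu]⟩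

/-- Substituting homogeneous polynomials in a multilinear map. -/
theorem comp_mem {ι : Type*} [Fintype ι] {G : Type*} [AddCommGroup G] [Module K G]
    (u : MultilinearMap K (fun _ : ι => G) F) (d : ι → ℕ) (c : ι → E → G)
    (hc : ∀ i, c i ∈ homPoly K E G (d i)) {m : ℕ} (hm : ∑ i, d i = m) :
    (fun x => u (fun i => c i x)) ∈ homPoly K E F m := by
  classical
  choose v hv using hc
  refine mem_of_card (ι := Σ i, Fin (d i)) (by simpa using hm) _ (u.compMultilinearMap v) ?_
  intro x
  simp only [MultilinearMap.compMultilinearMap_apply]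
  congr 1
  ext i
  exact hv i x

theorem id_mem : (fun x : E => x) ∈ homPoly K E E 1 :=
  ⟨(MultilinearMap.ofSubsingleton K E E (0 : Fin 1)) LinearMap.id, fun _ => rfl⟩

end Basic

section Jets

/-- The polynomial curves `t ↦ ∑ t ^ k • v_k` in a vector space. -/
def polyCurve (K F : Type*) [Field K] [AddCommGroup F] [Module K F] : Submodule K (K → F) :=
  Submodule.span K (Set.range fun p : ℕ × F => fun t : K => t ^ p.1 • p.2)

variable {K E F : Type*} [Field K] [AddCommGroup E] [Module K E] [AddCommGroup F] [Module K F]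

theorem monomial_mem_polyCurve (k : ℕ) (v : F) : (fun t : K => t ^ k • v) ∈ polyCurve K F :=
  Submodule.subset_span ⟨(k, v), rfl⟩

theorem const_mem_polyCurve (v : F) : (fun _ : K => v) ∈ polyCurve K F := by
  simpa using monomial_mem_polyCurve (K := K) 0 v

theorem pow_smul_mem_polyCurve (k : ℕ) {c : K → F} (hc : c ∈ polyCurve K F) :
    (fun t => t ^ k • c t) ∈ polyCurve K F := by
  induction hc using Submodule.span_induction with
  | mem x hx =>
    obtain ⟨p, rfl⟩ := hx
    simpa [smul_smul, pow_add] using monomial_mem_polyCurve (K := K) (k + p.1) p.2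
  | zero =>
    convert (polyCurve K F).zero_mem using 1
    ext t
    simp
  | add x y _ _ hx hy =>
    convert (polyCurve K F).add_mem hx hy using 1
    ext t
    simp
  | smul a x _ hx =>
    convert (polyCurve K F).smul_mem a hx using 1
    ext t
    simp [smul_comm a]

theorem multilinear_mem_polyCurve {ι : Type*} [Fintype ι]
    (u : MultilinearMap K (fun _ : ι => E) F) (c : ι → K → E) (hc : ∀ i, c i ∈ polyCurve K E) :
    (fun t => u (fun i => c i t)) ∈ polyCurve K F := by
  classical
  have h : ∀ i, ∃ k : ℕ × E →₀ K, ∀ t, c i t = ∑ p ∈ k.support, (k p * t ^ p.1) • p.2 := by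
    intro i
    obtain ⟨k, hk⟩ := (Finsupp.mem_span_range_iff_exists_finsupp).1 (hc i)
    refine ⟨k, fun t => ?_⟩
    rw [← hk]
    simp [Finsupp.sum, Finset.sum_apply, smul_smul]
  choose k hk using h
  have e : (fun t => u (fun i => c i t)) = ∑ r ∈ Fintype.piFinset (fun i => (k i).support),
      (∏ i, k i (r i)) • fun t : K => t ^ (∑ i, (r i).1) • u (fun i => (r i).2) := by
    ext t
    simp only [hk, Finset.sum_apply, Pi.smul_apply]
    rw [MultilinearMap.map_sum_finset]
    refine Finset.sum_congr rfl fun r _ => ?_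
    rw [MultilinearMap.map_smul_univ, Finset.prod_mul_distrib, Finset.prod_pow_eq_pow_sum,
      smul_smul]
  rw [e]
  exact Submodule.sum_mem _ fun r _ => Submodule.smul_mem _ _ (monomial_mem_polyCurve _ _)

/-- The curve `c` is polynomial of the form `c t = a + t b + t² R(t)`. -/
def HasJet (c : K → F) (a b : F) : Prop :=
  ∃ R ∈ polyCurve K F, ∀ t, c t = a + t • b + t ^ 2 • R t

theorem HasJet.unique [Infinite K] {c : K → F} {a b a' b' : F} (h : HasJet c a b)
    (h' : HasJet c a' b') : b = b' := by
  obtain ⟨R, hR, h⟩ := h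
  obtain ⟨R', hR', h'⟩ := h'
  have haa : a = a' := by simpa using (h 0).symm.trans (h' 0)
  subst haa
  rw [← sub_eq_zero, ← Module.forall_dual_apply_eq_zero_iff K]
  intro φ
  have key : ∀ c ∈ polyCurve K F, ∃ q : Polynomial K, ∀ t, φ (c t) = q.eval t := by
    intro c hc
    induction hc using Submodule.span_induction with
    | mem x hx =>
      obtain ⟨p, rfl⟩ := hx
      exact ⟨Polynomial.X ^ p.1 * Polynomial.C (φ p.2), fun t => by
        simp only [map_smul, smul_eq_mul, Polynomial.eval_mul, Polynomial.eval_pow,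
          Polynomial.eval_X, Polynomial.eval_C]⟩
    | zero => exact ⟨0, fun t => by simp⟩
    | add x y _ _ hx hy =>
      obtain ⟨q, hq⟩ := hx
      obtain ⟨q', hq'⟩ := hy
      exact ⟨q + q', fun t => by simp [hq, hq']⟩
    | smul a x _ hx =>
      obtain ⟨q, hq⟩ := hx
      exact ⟨Polynomial.C a * q, fun t => by simp [hq]⟩
  obtain ⟨q, hq⟩ := key _ (Submodule.sub_mem _ hR hR')
  have hz : Polynomial.X * (Polynomial.C (φ (b - b')) + Polynomial.X * q) = 0 := by
    apply Polynomial.funext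
    intro t
    have e : t • (b - b') + t ^ 2 • (R - R') t = 0 := by
      have := (h t).symm.trans (h' t)
      rw [add_assoc, add_assoc, add_right_inj] at this
      rw [Pi.sub_apply, smul_sub, smul_sub, ← sub_eq_zero.2 this]
      abel
    have e' := congrArg φ e
    rw [map_add, map_smul, map_smul, hq, map_zero, smul_eq_mul, smul_eq_mul] at e'
    simp only [Polynomial.eval_mul, Polynomial.eval_add, Polynomial.eval_X, Polynomial.eval_C,
      Polynomial.eval_zero]
    rw [← e']
    ring
  have := (mul_eq_zero.1 hz).resolve_left Polynomial.X_ne_zero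
  simpa using congrArg (Polynomial.eval 0) this

theorem hasJet_line (x y : E) : HasJet (fun t : K => x + t • y) x y :=
  ⟨0, Submodule.zero_mem _, fun t => by simp⟩

theorem HasJet.multilinear {ι : Type*} [Fintype ι] [DecidableEq ι]
    (u : MultilinearMap K (fun _ : ι => E) F) {c : ι → K → E} {a b : ι → E}
    (hc : ∀ i, HasJet (c i) (a i) (b i)) :
    HasJet (fun t => u (fun i => c i t)) (u a) (u.linearDeriv a b) := by
  choose R hR hc using hc
  let d : K → ι → E := fun t i => b i + t • R i t
  have hd : ∀ i, (fun t => d t i) ∈ polyCurve K E := fun i => by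
    refine Submodule.add_mem _ (const_mem_polyCurve _) ?_
    simpa using pow_smul_mem_polyCurve 1 (hR i)
  refine ⟨fun t => u.linearDeriv a (fun i => R i t) +
    ∑ s : Finset ι with 2 ≤ s.card, t ^ (s.card - 2) • u (s.piecewise (d t) a), ?_, ?_⟩
  · refine Submodule.add_mem _ ?_ ?_
    · simp only [MultilinearMap.linearDeriv_apply]
      have : (fun t => ∑ i, u (Function.update a i (R i t))) =
          ∑ i, fun t => u (Function.update a i (R i t)) := by ext t; simp
      rw [this]
      refine Submodule.sum_mem _ fun i _ => ?_
      refine multilinear_mem_polyCurve u (fun j t => Function.update a i (R i t) j) fun j => ?_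
      by_cases h : j = i
      · subst h; simpa using hR j
      · simpa [h] using const_mem_polyCurve (K := K) (a j)
    · have : (fun t => ∑ s : Finset ι with 2 ≤ s.card,
          t ^ (s.card - 2) • u (s.piecewise (d t) a)) =
          ∑ s : Finset ι with 2 ≤ s.card,
            fun t => t ^ (s.card - 2) • u (s.piecewise (d t) a) := by ext t; simp
      rw [this]
      refine Submodule.sum_mem _ fun s _ => pow_smul_mem_polyCurve _ ?_
      refine multilinear_mem_polyCurve u (fun j t => s.piecewise (d t) a j) fun j => ?_
      by_cases h : j ∈ s
      · simpa [h] using hd j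
      · simpa [h] using const_mem_polyCurve (K := K) (a j)
  · intro t
    have e : (fun i => c i t) = a + t • d t := by
      ext i
      simp [hc, d, smul_add, smul_smul, pow_two, add_assoc]
    have e2 : u.linearDeriv a (t • d t) =
        t • u.linearDeriv a b + t ^ 2 • u.linearDeriv a (fun i => R i t) := by
      have : d t = b + t • fun i => R i t := rfl
      rw [this, map_smul, map_add, map_smul, smul_add, smul_smul, pow_two]
    beta_reduce
    rw [e, MultilinearMap.map_add_eq_map_add_linearDeriv_add, e2, smul_add, Finset.smul_sum]
    have e3 : ∀ s ∈ Finset.univ.filter (fun s : Finset ι => 2 ≤ s.card),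
        u (s.piecewise (t • d t) a) =
          t ^ 2 • t ^ (s.card - 2) • u (s.piecewise (d t) a) := by
      intro s hs
      have hs : 2 ≤ s.card := by simpa using hs
      have := u.map_piecewise_smul (fun _ => t) (s.piecewise (d t) a) s
      rw [Finset.prod_const] at this
      rw [smul_smul, ← pow_add, Nat.add_sub_cancel' hs, ← this]
      congr 1
      ext j
      by_cases h : j ∈ s <;> simp [h]
    rw [Finset.sum_congr rfl e3]
    abel

end Jets

section Derivative

variable {K X F : Type*} [Field K] [AddCommGroup X] [Module K X] [AddCommGroup F] [Module K F]

/-- The derivative of the homogeneous polynomial `f` along `ξ`: if `f x = u (x, …, x)`, it is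
`x ↦ u (ξ x, x, …, x) + u (x, ξ x, x, …, x) + ⋯ + u (x, …, x, ξ x)`. Over an infinite field the
result does not depend on `u`, see `homPoly.deriv_eq`. -/
noncomputable def deriv {m : ℕ} (ξ : X → X) (f : homPoly K X F m) (x : X) : F :=
  ∑ i, f.2.choose (Function.update (fun _ => x) i (ξ x))

theorem hasJet_aux {ι : Type*} [Fintype ι] [DecidableEq ι] {f : X → F}
    (u : MultilinearMap K (fun _ : ι => X) F) (hu : ∀ x, f x = u (fun _ => x)) (x y : X) :
    HasJet (fun t : K => f (x + t • y)) (f x) (∑ i, u (Function.update (fun _ => x) i y)) := by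
  have := HasJet.multilinear u (c := fun _ t => x + t • y) fun _ => hasJet_line (K := K) x y
  simpa [hu] using this

theorem hasJet {m : ℕ} (ξ : X → X) (f : homPoly K X F m) (x : X) :
    HasJet (fun t : K => (f : X → F) (x + t • ξ x)) ((f : X → F) x) (deriv ξ f x) :=
  hasJet_aux _ f.2.choose_spec x (ξ x)

theorem deriv_eq [Infinite K] {ι : Type*} [Fintype ι] [DecidableEq ι] {m : ℕ} (ξ : X → X)
    (f : homPoly K X F m) (u : MultilinearMap K (fun _ : ι => X) F)
    (hu : ∀ x, (f : X → F) x = u (fun _ => x)) (x : X) :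
    deriv ξ f x = ∑ i, u (Function.update (fun _ => x) i (ξ x)) :=
  (hasJet ξ f x).unique (hasJet_aux u hu x (ξ x))

/-- The derivative along a homogeneous polynomial of degree `r` of a homogeneous polynomial of
degree `m` is homogeneous of degree `r + m - 1` (and vanishes when `m = 0`). -/
theorem deriv_mem {r m s : ℕ} (h : r + m = s + 1) (ξ : homPoly K X X r) (f : homPoly K X F m) :
    deriv (ξ : X → X) f ∈ homPoly K X F s := by
  have e : deriv (ξ : X → X) f = ∑ i, fun x =>
      f.2.choose (fun j => (if j = i then (ξ : X → X) else fun x => x) x) := by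
    ext x
    simp only [deriv, Finset.sum_apply]
    refine Finset.sum_congr rfl fun i _ => ?_
    congr 1
    ext j
    by_cases hj : j = i
    · subst hj; simp
    · simp [hj]
  rw [e]
  refine Submodule.sum_mem _ fun i _ => ?_
  refine comp_mem _ (fun j => if j = i then r else 1) _ (fun j => ?_) ?_
  · by_cases hj : j = i
    · simp [hj]
    · simp [hj, id_mem]
  · have hm : 0 < m := i.pos
    rw [Finset.sum_ite, Finset.sum_const, Finset.sum_const, Finset.filter_eq',
      Finset.filter_ne']
    simp
    omega

theorem deriv_add_left {m : ℕ} (ξ η : X → X) (f : homPoly K X F m) :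
    deriv (ξ + η) f = deriv ξ f + deriv η f := by
  ext x
  simp [deriv, Finset.sum_add_distrib]

theorem deriv_smul_left {m : ℕ} (c : K) (ξ : X → X) (f : homPoly K X F m) :
    deriv (c • ξ) f = c • deriv ξ f := by
  ext x
  simp [deriv, Finset.smul_sum]

theorem deriv_zero_left {m : ℕ} (f : homPoly K X F m) : deriv (0 : X → X) f = 0 := by
  simpa using deriv_smul_left (0 : K) 0 f

theorem deriv_sum_left {m : ℕ} {σ : Type*} (S : Finset σ) (ξ : σ → X → X) (f : homPoly K X F m) :
    deriv (∑ p ∈ S, ξ p) f = ∑ p ∈ S, deriv (ξ p) f := by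
  classical
  induction S using Finset.induction_on with
  | empty => simpa using deriv_zero_left f
  | insert a S ha ih => rw [Finset.sum_insert ha, Finset.sum_insert ha, deriv_add_left, ih]

theorem deriv_degree_zero (ξ : X → X) (f : homPoly K X F 0) : deriv ξ f = 0 := by
  ext x
  simp [deriv]

theorem deriv_add_right [Infinite K] {m : ℕ} (ξ : X → X) (f g : homPoly K X F m) :
    deriv ξ (f + g) = deriv ξ f + deriv ξ g := by
  ext x
  rw [deriv_eq ξ (f + g) (f.2.choose + g.2.choose) fun x => by
    simp [← f.2.choose_spec x, ← g.2.choose_spec x]]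
  simp [deriv, Finset.sum_add_distrib]

theorem deriv_smul_right [Infinite K] {m : ℕ} (ξ : X → X) (c : K) (f : homPoly K X F m) :
    deriv ξ (c • f) = c • deriv ξ f := by
  ext x
  rw [deriv_eq ξ (c • f) (c • f.2.choose) fun x => by simp [← f.2.choose_spec x]]
  simp [deriv, Finset.smul_sum]

/-- The part of the second derivative of `f` along `η` and `ξ` that does not involve derivatives
of `η` and `ξ`. -/
noncomputable def second {m : ℕ} (ξ η : X → X) (f : homPoly K X F m) (x : X) : F :=
  ∑ i, ∑ j, if j = i then 0 else
    f.2.choose (Function.update (Function.update (fun _ => x) i (η x)) j (ξ x))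

theorem second_comm {m : ℕ} (ξ η : X → X) (f : homPoly K X F m) (x : X) :
    second ξ η f x = second η ξ f x := by
  unfold second
  rw [Finset.sum_comm]
  refine Finset.sum_congr rfl fun i _ => Finset.sum_congr rfl fun j _ => ?_
  by_cases h : j = i
  · simp [h]
  · rw [if_neg h, if_neg (Ne.symm h), Function.update_comm h]

theorem HasJet.sum {σ : Type*} (S : Finset σ) {c : σ → K → F} {a b : σ → F}
    (h : ∀ p ∈ S, HasJet (c p) (a p) (b p)) :
    HasJet (fun t => ∑ p ∈ S, c p t) (∑ p ∈ S, a p) (∑ p ∈ S, b p) := by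
  classical
  induction S using Finset.induction_on with
  | empty => exact ⟨0, Submodule.zero_mem _, fun t => by simp⟩
  | insert p S hp ih =>
    obtain ⟨R, hR, e⟩ := ih fun q hq => h q (Finset.mem_insert_of_mem hq)
    obtain ⟨R', hR', e'⟩ := h p (Finset.mem_insert_self p S)
    refine ⟨R' + R, Submodule.add_mem _ hR' hR, fun t => ?_⟩
    beta_reduce at e ⊢
    rw [Finset.sum_insert hp, Finset.sum_insert hp, Finset.sum_insert hp, e, e']
    simp only [smul_add, Pi.add_apply]
    abel

theorem hasJet_deriv {p m : ℕ} (ξ : X → X) (η : homPoly K X X p) (f : homPoly K X F m) (x : X) :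
    HasJet (fun t : K => deriv (η : X → X) f (x + t • ξ x)) (deriv (η : X → X) f x)
      (second ξ η f x + deriv (deriv ξ η) f x) := by
  have key : ∀ i, HasJet
      (fun t : K => f.2.choose (Function.update (fun _ => x + t • ξ x) i
        ((η : X → X) (x + t • ξ x))))
      (f.2.choose (Function.update (fun _ => x) i ((η : X → X) x)))
      ((∑ j, if j = i then 0 else f.2.choose (Function.update
        (Function.update (fun _ => x) i ((η : X → X) x)) j (ξ x))) +
        f.2.choose (Function.update (fun _ => x) i (deriv ξ η x))) := by
    intro i
    have := HasJet.multilinear f.2.choose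
      (c := fun j t => Function.update (fun _ => x + t • ξ x) i ((η : X → X) (x + t • ξ x)) j)
      (a := Function.update (fun _ => x) i ((η : X → X) x))
      (b := Function.update (fun _ => ξ x) i (deriv ξ η x)) fun j => by
        by_cases h : j = i
        · subst h
          simpa using hasJet ξ η x
        · simpa [h] using hasJet_line (K := K) x (ξ x)
    convert this using 1
    rw [MultilinearMap.linearDeriv_apply, ← Finset.sum_erase_add _ _ (Finset.mem_univ i),
      ← Finset.sum_erase_add _ _ (Finset.mem_univ i)]
    simp only [if_true, add_zero, Function.update_self, Function.update_idem]
    congr 1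
    refine Finset.sum_congr rfl fun j hj => ?_
    have hj : j ≠ i := Finset.ne_of_mem_erase hj
    rw [if_neg hj, Function.update_of_ne hj]
  have := HasJet.sum Finset.univ fun i _ => key i
  rw [Finset.sum_add_distrib] at this
  exact this

end Derivative

end homPoly

/-- `F[[E]] = ∏ₘ F[E]_m`: the formal series with variables in `E` and coefficients in `F`. -/
def FormalSeries (K E F : Type*) [Field K] [AddCommGroup E] [Module K E] [AddCommGroup F]
    [Module K F] : Type _ :=
  ∀ m : ℕ, homPoly K E F m

namespace FormalSeries

section

variable {K E F : Type*} [Field K] [AddCommGroup E] [Module K E] [AddCommGroup F] [Module K F]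

noncomputable instance : AddCommGroup (FormalSeries K E F) :=
  inferInstanceAs (AddCommGroup (∀ m : ℕ, homPoly K E F m))

noncomputable instance : Module K (FormalSeries K E F) :=
  inferInstanceAs (Module K (∀ m : ℕ, homPoly K E F m))

/-- The homogeneous component of degree `m`, as a map `E → F`. -/
def comp (f : FormalSeries K E F) (m : ℕ) : E → F := (f m : E → F)

@[ext] theorem ext {f g : FormalSeries K E F} (h : ∀ m x, f.comp m x = g.comp m x) : f = g :=
  funext fun m => Subtype.ext (funext (h m))

@[simp] theorem comp_add (f g : FormalSeries K E F) (m : ℕ) :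
    (f + g).comp m = f.comp m + g.comp m := rfl

@[simp] theorem comp_sub (f g : FormalSeries K E F) (m : ℕ) :
    (f - g).comp m = f.comp m - g.comp m := rfl

@[simp] theorem comp_smul (c : K) (f : FormalSeries K E F) (m : ℕ) :
    (c • f).comp m = c • f.comp m := rfl

end

section Derivative

variable {K X F : Type*} [Field K] [AddCommGroup X] [Module K X] [AddCommGroup F] [Module K F]

open Finset

/-- The derivative `ξ.f` of the formal series `f` along the formal series `ξ`: its component of
degree `s` is the sum of the derivatives `ξ_r.f_m` over all `r, m` with `r + m - 1 = s`. -/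
noncomputable def deriv (ξ : FormalSeries K X X) (f : FormalSeries K X F) : FormalSeries K X F :=
  fun s => ⟨∑ p ∈ antidiagonal (s + 1), homPoly.deriv (ξ p.1 : X → X) (f p.2),
    Submodule.sum_mem _ fun _ hp => homPoly.deriv_mem (HasAntidiagonal.mem_antidiagonal.1 hp) _ _⟩

theorem comp_deriv (ξ : FormalSeries K X X) (f : FormalSeries K X F) (s : ℕ) :
    (deriv ξ f).comp s =
      ∑ p ∈ antidiagonal (s + 1), homPoly.deriv (ξ p.1 : X → X) (f p.2) := rfl

theorem deriv_add_left (ξ η : FormalSeries K X X) (f : FormalSeries K X F) :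
    deriv (ξ + η) f = deriv ξ f + deriv η f := by
  ext s x
  have : ∀ n, (((ξ + η) n : homPoly K X X n) : X → X) = (ξ n : X → X) + (η n : X → X) :=
    fun _ => rfl
  simp [comp_deriv, this, homPoly.deriv_add_left, sum_add_distrib]

theorem deriv_add_right [Infinite K] (ξ : FormalSeries K X X) (f g : FormalSeries K X F) :
    deriv ξ (f + g) = deriv ξ f + deriv ξ g := by
  ext s x
  have : ∀ n, (f + g) n = f n + g n := fun _ => rfl
  simp [comp_deriv, this, homPoly.deriv_add_right, sum_add_distrib]

theorem deriv_smul_left (c : K) (ξ : FormalSeries K X X) (f : FormalSeries K X F) :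
    deriv (c • ξ) f = c • deriv ξ f := by
  ext s x
  have : ∀ n, (((c • ξ) n : homPoly K X X n) : X → X) = c • (ξ n : X → X) := fun _ => rfl
  simp [comp_deriv, this, homPoly.deriv_smul_left, smul_sum]

theorem deriv_smul_right [Infinite K] (c : K) (ξ : FormalSeries K X X) (f : FormalSeries K X F) :
    deriv ξ (c • f) = c • deriv ξ f := by
  ext s x
  have : ∀ n, (c • f) n = c • f n := fun _ => rfl
  simp [comp_deriv, this, homPoly.deriv_smul_right, smul_sum]

theorem sum_reindex {M : Type*} [AddCommMonoid M] (H : ℕ → ℕ → ℕ → M) (s : ℕ)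
    (h : ∀ r, H r 0 0 = 0) :
    ∑ q ∈ antidiagonal (s + 1), ∑ p ∈ antidiagonal (q.2 + 1), H q.1 p.1 p.2 =
      ∑ q ∈ antidiagonal (s + 2), ∑ p ∈ antidiagonal q.2, H q.1 p.1 p.2 := by
  rw [Nat.sum_antidiagonal_succ' (n := s + 1)]
  simp [h]

theorem sum_reindex' {M : Type*} [AddCommMonoid M] (H : ℕ → ℕ → ℕ → M) (s : ℕ)
    (h : ∀ m, H 0 0 m = 0) :
    ∑ q ∈ antidiagonal (s + 1), ∑ p ∈ antidiagonal (q.1 + 1), H p.1 p.2 q.2 =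
      ∑ q ∈ antidiagonal (s + 2), ∑ p ∈ antidiagonal q.1, H p.1 p.2 q.2 := by
  rw [Nat.sum_antidiagonal_succ (n := s + 1)]
  simp [h]

theorem sum_assoc {M : Type*} [AddCommMonoid M] (H : ℕ → ℕ → ℕ → M) (n : ℕ) :
    ∑ q ∈ antidiagonal n, ∑ p ∈ antidiagonal q.2, H q.1 p.1 p.2 =
      ∑ q ∈ antidiagonal n, ∑ p ∈ antidiagonal q.1, H p.1 p.2 q.2 := by
  rw [sum_sigma', sum_sigma']
  refine sum_nbij' (fun a => ⟨(a.1.1 + a.2.1, a.2.2), (a.1.1, a.2.1)⟩)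
    (fun a => ⟨(a.2.1, a.2.2 + a.1.2), (a.2.2, a.1.2)⟩) ?_ ?_ ?_ ?_ ?_
  · rintro ⟨⟨a, b⟩, ⟨c, d⟩⟩ h
    simp only [mem_sigma, HasAntidiagonal.mem_antidiagonal, and_true] at h ⊢
    omega
  · rintro ⟨⟨a, b⟩, ⟨c, d⟩⟩ h
    simp only [mem_sigma, HasAntidiagonal.mem_antidiagonal, and_true] at h ⊢
    omega
  · rintro ⟨⟨a, b⟩, ⟨c, d⟩⟩ h
    simp only [mem_sigma, HasAntidiagonal.mem_antidiagonal] at h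
    obtain ⟨-, rfl⟩ := h
    rfl
  · rintro ⟨⟨a, b⟩, ⟨c, d⟩⟩ h
    simp only [mem_sigma, HasAntidiagonal.mem_antidiagonal] at h
    obtain ⟨-, rfl⟩ := h
    rfl
  · intros
    rfl

theorem comp_deriv_deriv [Infinite K] (ξ η : FormalSeries K X X) (f : FormalSeries K X F)
    (s : ℕ) (x : X) :
    (deriv ξ (deriv η f)).comp s x =
      ∑ q ∈ antidiagonal (s + 2), ∑ p ∈ antidiagonal q.1,
        homPoly.second (ξ p.1 : X → X) (η p.2 : X → X) (f q.2) x +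
      (deriv (deriv ξ η) f).comp s x := by
  have h1 : (deriv ξ (deriv η f)).comp s x =
      ∑ q ∈ antidiagonal (s + 1), ∑ p ∈ antidiagonal (q.2 + 1),
        (homPoly.second (ξ q.1 : X → X) (η p.1 : X → X) (f p.2) x +
          homPoly.deriv (homPoly.deriv (ξ q.1 : X → X) (η p.1)) (f p.2) x) := by
    rw [comp_deriv, Finset.sum_apply]
    refine sum_congr rfl fun q _ => ?_
    refine (homPoly.hasJet (ξ q.1 : X → X) (deriv η f q.2) x).unique
      (a' := ∑ p ∈ antidiagonal (q.2 + 1), homPoly.deriv (η p.1 : X → X) (f p.2) x) ?_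
    convert homPoly.HasJet.sum (antidiagonal (q.2 + 1)) fun p _ =>
      homPoly.hasJet_deriv (ξ q.1 : X → X) (η p.1) (f p.2) x using 1
    ext t
    exact Finset.sum_apply (x + t • (ξ q.1 : X → X) x) (antidiagonal (q.2 + 1))
      fun p => homPoly.deriv (η p.1 : X → X) (f p.2)
  have h2 : (deriv (deriv ξ η) f).comp s x =
      ∑ q ∈ antidiagonal (s + 1), ∑ p ∈ antidiagonal (q.1 + 1),
        homPoly.deriv (homPoly.deriv (ξ p.1 : X → X) (η p.2)) (f q.2) x := by
    rw [comp_deriv, Finset.sum_apply]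
    refine sum_congr rfl fun q _ => ?_
    have : (deriv ξ η q.1 : X → X) = ∑ p ∈ antidiagonal (q.1 + 1),
      homPoly.deriv (ξ p.1 : X → X) (η p.2) := rfl
    rw [this, homPoly.deriv_sum_left, Finset.sum_apply]
  rw [h1, h2, sum_reindex (fun r p m => homPoly.second (ξ r : X → X) (η p : X → X) (f m) x +
      homPoly.deriv (homPoly.deriv (ξ r : X → X) (η p)) (f m) x),
    sum_reindex' (fun r p m => homPoly.deriv (homPoly.deriv (ξ r : X → X) (η p)) (f m) x),
    sum_assoc (fun r p m => homPoly.second (ξ r : X → X) (η p : X → X) (f m) x +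
      homPoly.deriv (homPoly.deriv (ξ r : X → X) (η p)) (f m) x), ← sum_add_distrib]
  · exact sum_congr rfl fun _ _ => sum_add_distrib
  · intro m
    rw [homPoly.deriv_degree_zero, homPoly.deriv_zero_left]
    rfl
  · intro r
    rw [homPoly.deriv_degree_zero]
    simp [homPoly.second]

theorem deriv_sub_left (ξ η : FormalSeries K X X) (f : FormalSeries K X F) :
    deriv (ξ - η) f = deriv ξ f - deriv η f := by
  rw [eq_sub_iff_add_eq, ← deriv_add_left, sub_add_cancel]

theorem deriv_sub_right [Infinite K] (ξ : FormalSeries K X X) (f g : FormalSeries K X F) :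
    deriv ξ (f - g) = deriv ξ f - deriv ξ g := by
  rw [eq_sub_iff_add_eq, ← deriv_add_right, sub_add_cancel]

/-- `ξ.(η.f) - η.(ξ.f) = (ξ.η - η.ξ).f`. -/
theorem deriv_deriv_sub [Infinite K] (ξ η : FormalSeries K X X) (f : FormalSeries K X F) :
    deriv ξ (deriv η f) - deriv η (deriv ξ f) = deriv (deriv ξ η - deriv η ξ) f := by
  have : ∀ s x, ∑ q ∈ antidiagonal (s + 2), ∑ p ∈ antidiagonal q.1,
        homPoly.second (ξ p.1 : X → X) (η p.2 : X → X) (f q.2) x =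
      ∑ q ∈ antidiagonal (s + 2), ∑ p ∈ antidiagonal q.1,
        homPoly.second (η p.1 : X → X) (ξ p.2 : X → X) (f q.2) x := by
    intro s x
    refine sum_congr rfl fun q _ => ?_
    rw [← Nat.sum_antidiagonal_swap]
    exact sum_congr rfl fun p _ => homPoly.second_comm _ _ _ _
  ext s x
  rw [deriv_sub_left, comp_sub, comp_sub, Pi.sub_apply, Pi.sub_apply, comp_deriv_deriv,
    comp_deriv_deriv, this]
  abel

/-- The Lie algebra `S(X) = X[[X]]`, with bracket `[ξ, η] = ξ.η - η.ξ`. -/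
noncomputable instance [Infinite K] : LieRing (FormalSeries K X X) where
  bracket ξ η := deriv ξ η - deriv η ξ
  add_lie a b c := by
    change deriv (a + b) c - deriv c (a + b) = (deriv a c - deriv c a) + (deriv b c - deriv c b)
    rw [deriv_add_left, deriv_add_right]
    abel
  lie_add a b c := by
    change deriv a (b + c) - deriv (b + c) a = (deriv a b - deriv b a) + (deriv a c - deriv c a)
    rw [deriv_add_left, deriv_add_right]
    abel
  lie_self a := sub_self _
  leibniz_lie a b c := by
    change deriv a (deriv b c - deriv c b) - deriv (deriv b c - deriv c b) a =
      (deriv (deriv a b - deriv b a) c - deriv c (deriv a b - deriv b a)) +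
      (deriv b (deriv a c - deriv c a) - deriv (deriv a c - deriv c a) b)
    rw [← deriv_deriv_sub, ← deriv_deriv_sub, ← deriv_deriv_sub]
    simp only [deriv_sub_right]
    abel

theorem lie_def [Infinite K] (ξ η : FormalSeries K X X) : ⁅ξ, η⁆ = deriv ξ η - deriv η ξ := rfl

noncomputable instance [Infinite K] : LieAlgebra K (FormalSeries K X X) where
  lie_smul c ξ η := by
    rw [lie_def, lie_def, deriv_smul_left, deriv_smul_right, smul_sub]

end Derivative

end FormalSeries

/-- A formal (right) action of the Lie algebra `A` on the vector space `X`: a homomorphism of Lie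
algebras `A → S(X)`. -/
abbrev FormalAction (K A X : Type*) [Field K] [Infinite K] [LieRing A] [LieAlgebra K A]
    [AddCommGroup X] [Module K X] :=
  A →ₗ⁅K⁆ FormalSeries K X X

/-- Together with `NormableLieAlgebra`: a normable Lie algebra, i.e. a Lie algebra with a topology
defined by a norm for which the bracket is continuous. -/
class NormableLieRing (A : Type*) extends NormedAddCommGroup A, LieRing A where
  continuous_lie : Continuous fun p : A × A => ⁅p.1, p.2⁆

/-- The scalar multiplication of a normable Lie algebra. -/
class NormableLieAlgebra (𝕜 A : Type*) [RCLike 𝕜] [NormableLieRing A] extends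
  NormedSpace 𝕜 A, LieAlgebra 𝕜 A

section Analytic

variable (𝕜 : Type*) [RCLike 𝕜] {X F : Type*} [NormedAddCommGroup X] [NormedSpace 𝕜 X]
  [NormedAddCommGroup F] [NormedSpace 𝕜 F]

/-- The derivative `ξ(f) : x ↦ d_x f (ξ(x))` of a function along a vector field. -/
noncomputable def vectorFieldDeriv (ξ : X → X) (f : X → F) (x : X) : F :=
  fderiv 𝕜 f x (ξ x)

/-- The Taylor series at `0`, with components `x ↦ (1 / m!) d^m f(0) (x, …, x)`. -/
noncomputable def taylorSeriesAtZero (f : X → F) : FormalSeries 𝕜 X F := fun m =>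
  ⟨fun x => (m.factorial : 𝕜)⁻¹ • iteratedFDeriv 𝕜 m f 0 (fun _ => x),
    (m.factorial : 𝕜)⁻¹ • (iteratedFDeriv 𝕜 m f 0).toMultilinearMap, fun _ => rfl⟩

variable {𝕜} in
/-- The formal series `s` has continuous components, determined by a power series `p` which
converges to `f` on a ball with center `0` and positive radius. -/
def FormalSeries.Represents (s : FormalSeries 𝕜 X F) (f : X → F) : Prop :=
  ∃ p : FormalMultilinearSeries 𝕜 X F, HasFPowerSeriesAt f p 0 ∧
    ∀ m x, s.comp m x = p m (fun _ => x)

/-- `a ↦ ξ_a` is an analytic infinitesimal right operation law of `A` on the open set `U`: the map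
`(a, x) ↦ ξ_a(x)` is an analytic morphism from the trivial vector bundle `A × U` to the tangent
bundle `T(U) = U × X`, and `[ξ_a, ξ_b] = ξ_[a,b]` on `U`. Only the values of `ξ_a` on `U` matter. -/
structure IsInfinitesimalRightLaw {A : Type*} [NormableLieRing A] [NormableLieAlgebra 𝕜 A]
    (U : Set X) (ξ : A → X → X) : Prop where
  isLinearMap : ∀ x ∈ U, IsLinearMap 𝕜 fun a => ξ a x
  analytic : AnalyticOnNhd 𝕜 (fun p : A × X => ξ p.1 p.2) (Set.univ ×ˢ U)
  lieBracket : ∀ a b, ∀ x ∈ U, VectorField.lieBracket 𝕜 (ξ a) (ξ b) x = ξ ⁅a, b⁆ x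

end Analytic

/-! Write T for the Taylor series at 0. Everything rests on the identity T(ξ(f)) = T(ξ).T(f)
(`taylorSeriesAtZero_vectorFieldDeriv`). On U the vector field bracket is ξ_a(ξ_b) - ξ_b(ξ_a), each
field being regarded as an X-valued function. Since T is linear on analytic germs and sees only the
germ at 0, applying T to the law [ξ_a, ξ_b] = ξ_[a,b] gives D_a.D_b - D_b.D_a = D_[a,b].

To prove the identity, fix x and restrict to the line t ↦ t x. If f = ∑ p_m and ξ = ∑ q_r, the
operators f'(t x) and the vectors ξ(t x) are absolutely convergent series in t for small t. Their
Cauchy product (`ContinuousLinearMap.hasSum_antidiagonal_apply`) expands ξ(f)(t x). By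
`FormalMultilinearSeries.derivSeries_apply` its t^s coefficient is the degree s component of
T(ξ).T(f) at x, and uniqueness of expansions in one variable concludes. -/

open Finset Filter Topology

/-! ### Power series on lines, Cauchy products, and the series of the derivative. -/

section PowerSeries

variable {𝕜 : Type*} [NontriviallyNormedField 𝕜] {E F : Type*} [NormedAddCommGroup E] [NormedSpace 𝕜 E]
  [NormedAddCommGroup F] [NormedSpace 𝕜 F]

/-- A function of one variable has at most one expansion in powers of the variable. -/
theorem eq_of_eventually_hasSum_pow_smul {a b : ℕ → F} {φ : 𝕜 → F}
    (ha : ∀ᶠ t in 𝓝 (0 : 𝕜), HasSum (fun n => t ^ n • a n) (φ t))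
    (hb : ∀ᶠ t in 𝓝 (0 : 𝕜), HasSum (fun n => t ^ n • b n) (φ t)) : a = b := by
  -- `mkPiRing` makes c n an n-linear map with value c n at (1, …, 1), so uniqueness of power series
  -- on `𝕜` applies.
  have key : ∀ c : ℕ → F, (∀ᶠ t in 𝓝 (0 : 𝕜), HasSum (fun n => t ^ n • c n) (φ t)) →
      HasFPowerSeriesAt φ (fun n => ContinuousMultilinearMap.mkPiRing 𝕜 (Fin n) (c n) :
        FormalMultilinearSeries 𝕜 𝕜 F) 0 := fun c hc =>
    hasFPowerSeriesAt_iff.2 (by simpa [FormalMultilinearSeries.coeff] using hc)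
  have h := (key a ha).eq_formalMultilinearSeries (key b hb)
  funext n
  simpa using congrArg (fun p : FormalMultilinearSeries 𝕜 𝕜 F => p n fun _ => 1) h

theorem ContinuousMultilinearMap.apply_smul_const {n : ℕ} (u : E [×n]→L[𝕜] F) (t : 𝕜) (x : E) :
    (u fun _ => t • x) = t ^ n • u fun _ => x := by
  simpa using u.map_smul_univ (fun _ => t) fun _ => x

theorem tendsto_smul_nhds_zero (x : E) : Tendsto (fun t : 𝕜 => t • x) (𝓝 0) (𝓝 0) := by
  have : Continuous fun t : 𝕜 => t • x := by fun_prop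
  simpa using this.tendsto 0

/-- On each line through the origin, a power series is an expansion in powers of the parameter. -/
theorem HasFPowerSeriesAt.eventually_hasSum_pow_smul {f : E → F}
    {p : FormalMultilinearSeries 𝕜 E F} (h : HasFPowerSeriesAt f p 0) (x : E) :
    ∀ᶠ t in 𝓝 (0 : 𝕜), HasSum (fun n => t ^ n • p n fun _ => x) (f (t • x)) := by
  filter_upwards [(tendsto_smul_nhds_zero x).eventually h.eventually_hasSum] with t ht
  simpa only [ContinuousMultilinearMap.apply_smul_const, zero_add] using ht

theorem HasFPowerSeriesAt.eventually_summable_norm_pow_smul {f : E → F}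
    {p : FormalMultilinearSeries 𝕜 E F} (h : HasFPowerSeriesAt f p 0) (x : E) :
    ∀ᶠ t in 𝓝 (0 : 𝕜), Summable fun n => ‖t ^ n • p n fun _ => x‖ := by
  filter_upwards [(tendsto_smul_nhds_zero x).eventually
    (Metric.eball_mem_nhds 0 h.radius_pos)] with t ht
  simpa only [ContinuousMultilinearMap.apply_smul_const] using p.summable_norm_apply ht

/-- This is the Cauchy product for evaluation of operators. The bound ‖u v‖ ≤ ‖u‖ ‖v‖ makes the
double family summable, so it may be summed by rows or by antidiagonals. The index of the vector
comes first, as in `FormalSeries.deriv`. -/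
theorem ContinuousLinearMap.hasSum_antidiagonal_apply [CompleteSpace F] {u : ℕ → E →L[𝕜] F}
    {v : ℕ → E} {a : E →L[𝕜] F} {b : E} (hu : HasSum u a) (hv : HasSum v b)
    (hu' : Summable fun n => ‖u n‖) (hv' : Summable fun n => ‖v n‖) :
    HasSum (fun n => ∑ q ∈ antidiagonal n, u q.2 (v q.1)) (a b) := by
  have hs : Summable fun q : ℕ × ℕ => u q.2 (v q.1) := by
    refine Summable.of_norm_bounded (g := fun q : ℕ × ℕ => ‖v q.1‖ * ‖u q.2‖)
      (hv'.mul_of_nonneg hu' (fun _ => norm_nonneg _) fun _ => norm_nonneg _) fun q => ?_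
    rw [mul_comm]
    exact (u q.2).le_opNorm _
  -- For fixed r the row sums to a (v r), and these rows sum to a b.
  have hab : HasSum (fun q : ℕ × ℕ => u q.2 (v q.1)) (a b) := by
    have h1 : HasSum (fun r => a (v r)) (a b) := a.hasSum hv
    have h2 := hs.hasSum.prod_fiberwise (g := fun r => a (v r)) fun r =>
      (ContinuousLinearMap.apply 𝕜 F (v r)).hasSum hu
    rw [h1.unique h2]
    exact hs.hasSum
  refine (HasAntidiagonal.sigmaAntidiagonalEquivProd.hasSum_iff.2 hab).sigma fun n => ?_
  rw [← Finset.sum_coe_sort (antidiagonal n) fun q => u q.2 (v q.1)]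
  exact hasSum_fintype _

/-- The derivative keeps the terms linear in the shift when p is re-expanded at a new origin. They
are indexed by the n-element sets s of positions that keep x, with y in the one remaining position.
No symmetry of p is needed. -/
theorem FormalMultilinearSeries.derivSeries_apply (p : FormalMultilinearSeries 𝕜 E F) (n : ℕ)
    (x y : E) :
    p.derivSeries n (fun _ => x) y = ∑ i, p (n + 1) (Function.update (fun _ => x) i y) := by
  have h : p.derivSeries n (fun _ => x) y =
      ∑ i, p (1 + n) (Function.update (fun _ => x) i y) := by
    simp only [derivSeries, ContinuousLinearMap.compFormalMultilinearSeries_apply,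
      changeOriginSeries, ContinuousLinearMap.compContinuousMultilinearMap_coe,
      ContinuousLinearEquiv.coe_coe, LinearIsometryEquiv.coe_coe, Function.comp_apply, map_sum,
      _root_.sum_apply, continuousMultilinearCurryFin1_apply]
    -- The position i of y corresponds to s = {i}ᶜ.
    refine (Finset.sum_bij (fun i _ => ⟨univ.erase i, by simp⟩) (by simp) ?_ ?_ ?_).symm
    · intro i _ j _ hij
      simpa [Finset.erase_inj] using hij
    · rintro ⟨s, hs⟩ -
      obtain ⟨i, hi⟩ : ∃ i, sᶜ = {i} := by
        rw [← Finset.card_eq_one, Finset.card_compl, hs]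
        simp
      refine ⟨i, mem_univ _, Subtype.ext ?_⟩
      change univ.erase i = s
      rw [← Finset.compl_singleton, ← hi, compl_compl]
    · intro i _
      rw [Fin.snoc_zero, changeOriginSeriesTerm_apply]
      congr 1
      ext j
      by_cases hj : j = i
      · subst hj; simp
      · simp [hj]
  rw [h, add_comm]

end PowerSeries

/-! ### Taylor series at 0 and derivatives along vector fields. -/

section TaylorSeries

variable {𝕜 : Type*} [RCLike 𝕜] {X F : Type*} [NormedAddCommGroup X] [NormedSpace 𝕜 X]
  [NormedAddCommGroup F] [NormedSpace 𝕜 F]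

theorem taylorSeriesAtZero_congr {f g : X → F} (h : f =ᶠ[𝓝 0] g) :
    taylorSeriesAtZero 𝕜 f = taylorSeriesAtZero 𝕜 g := by
  ext m x
  change (m.factorial : 𝕜)⁻¹ • iteratedFDeriv 𝕜 m f 0 (fun _ => x) =
    (m.factorial : 𝕜)⁻¹ • iteratedFDeriv 𝕜 m g 0 (fun _ => x)
  rw [(h.iteratedFDeriv 𝕜 m).eq_of_nhds]

variable [CompleteSpace F]

/-- The m-th derivative is a sum of p m over all permutations of its arguments, so it equals m! p m
on the diagonal even when p m is not symmetric. -/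
theorem HasFPowerSeriesAt.comp_taylorSeriesAtZero {f : X → F}
    {p : FormalMultilinearSeries 𝕜 X F} (h : HasFPowerSeriesAt f p 0) (m : ℕ) (x : X) :
    (taylorSeriesAtZero 𝕜 f).comp m x = p m fun _ => x := by
  obtain ⟨r, hr⟩ := h
  change (m.factorial : 𝕜)⁻¹ • iteratedFDeriv 𝕜 m f 0 (fun _ => x) = _
  rw [← hr.factorial_smul x m, ← Nat.cast_smul_eq_nsmul 𝕜, smul_smul,
    inv_mul_cancel₀ (Nat.cast_ne_zero.2 m.factorial_ne_zero), one_smul]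

theorem AnalyticAt.represents_taylorSeriesAtZero {f : X → F} (h : AnalyticAt 𝕜 f 0) :
    (taylorSeriesAtZero 𝕜 f).Represents f := by
  obtain ⟨p, hp⟩ := h
  exact ⟨p, hp, hp.comp_taylorSeriesAtZero⟩

theorem taylorSeriesAtZero_add {f g : X → F} (hf : AnalyticAt 𝕜 f 0) (hg : AnalyticAt 𝕜 g 0) :
    taylorSeriesAtZero 𝕜 (f + g) = taylorSeriesAtZero 𝕜 f + taylorSeriesAtZero 𝕜 g := by
  obtain ⟨p, hp⟩ := hf
  obtain ⟨q, hq⟩ := hg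
  ext m x
  rw [(hp.add hq).comp_taylorSeriesAtZero, FormalSeries.comp_add, Pi.add_apply,
    hp.comp_taylorSeriesAtZero, hq.comp_taylorSeriesAtZero]
  rfl

theorem taylorSeriesAtZero_smul (c : 𝕜) {f : X → F} (hf : AnalyticAt 𝕜 f 0) :
    taylorSeriesAtZero 𝕜 (c • f) = c • taylorSeriesAtZero 𝕜 f := by
  obtain ⟨p, hp⟩ := hf
  ext m x
  rw [hp.const_smul.comp_taylorSeriesAtZero, FormalSeries.comp_smul, Pi.smul_apply,
    hp.comp_taylorSeriesAtZero]
  rfl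

theorem taylorSeriesAtZero_sub {f g : X → F} (hf : AnalyticAt 𝕜 f 0) (hg : AnalyticAt 𝕜 g 0) :
    taylorSeriesAtZero 𝕜 (f - g) = taylorSeriesAtZero 𝕜 f - taylorSeriesAtZero 𝕜 g := by
  rw [eq_sub_iff_add_eq, ← taylorSeriesAtZero_add (hf.sub hg) hg, sub_add_cancel]

/-- The identity of `X →L[𝕜] F`, read as a bilinear map, is evaluation (u, y) ↦ u y; it is composed
with x ↦ (f'(x), ξ(x)). -/
theorem AnalyticAt.vectorFieldDeriv {ξ : X → X} {f : X → F} (hξ : AnalyticAt 𝕜 ξ 0)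
    (hf : AnalyticAt 𝕜 f 0) : AnalyticAt 𝕜 (vectorFieldDeriv 𝕜 ξ f) 0 :=
  (ContinuousLinearMap.id 𝕜 (X →L[𝕜] F)).analyticAt_bilinear (fderiv 𝕜 f 0, ξ 0) |>.comp₂
    hf.fderiv hξ

/-- `homPoly.deriv` does not depend on the multilinear map chosen, so p (n + 1) can be used, and
both sides become the same sum over positions. -/
theorem homPoly.deriv_taylorSeriesAtZero_succ {f : X → F} {p : FormalMultilinearSeries 𝕜 X F}
    (h : HasFPowerSeriesAt f p 0) (ξ : X → X) (n : ℕ) (x : X) :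
    homPoly.deriv ξ (taylorSeriesAtZero 𝕜 f (n + 1)) x = p.derivSeries n (fun _ => x) (ξ x) := by
  rw [p.derivSeries_apply, homPoly.deriv_eq ξ _ (p (n + 1)).toMultilinearMap
    (h.comp_taylorSeriesAtZero (n + 1))]
  rfl

/-- The Taylor series of the derivative of a function along a vector field is the derivative of
the Taylor series of the function along the Taylor series of the vector field. -/
theorem taylorSeriesAtZero_vectorFieldDeriv {ξ : X → X} {f : X → F} [CompleteSpace X]
    (hξ : AnalyticAt 𝕜 ξ 0) (hf : AnalyticAt 𝕜 f 0) :
    taylorSeriesAtZero 𝕜 (vectorFieldDeriv 𝕜 ξ f) =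
      FormalSeries.deriv (taylorSeriesAtZero 𝕜 ξ) (taylorSeriesAtZero 𝕜 f) := by
  obtain ⟨g, hg⟩ := hξ.vectorFieldDeriv hf
  obtain ⟨q, hq⟩ := hξ
  obtain ⟨p, hp⟩ := hf
  have hp' : HasFPowerSeriesAt (fderiv 𝕜 f) p.derivSeries 0 := by
    obtain ⟨r, hr⟩ := hp
    exact ⟨r, hr.fderiv⟩
  ext s x
  have hd : (FormalSeries.deriv (taylorSeriesAtZero 𝕜 ξ) (taylorSeriesAtZero 𝕜 f)).comp s x =
      ∑ n ∈ antidiagonal s, p.derivSeries n.2 (fun _ => x) (q n.1 fun _ => x) := by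
    -- The term with f of degree 0 vanishes. In the others the degree of f is n.2 + 1, which turns
    -- pairs of sum s + 1 into pairs of sum s.
    rw [FormalSeries.comp_deriv, Finset.sum_apply, Nat.sum_antidiagonal_succ',
      homPoly.deriv_degree_zero, Pi.zero_apply, zero_add]
    refine Finset.sum_congr rfl fun n _ => ?_
    rw [homPoly.deriv_taylorSeriesAtZero_succ hp]
    exact congrArg _ (hq.comp_taylorSeriesAtZero n.1 x)
  rw [hd, hg.comp_taylorSeriesAtZero]
  -- With x fixed, both sides are the coefficients of an expansion of t ↦ ξ(f)(t x).
  refine congrFun (eq_of_eventually_hasSum_pow_smul (hg.eventually_hasSum_pow_smul x) (b := fun s =>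
    ∑ n ∈ antidiagonal s, p.derivSeries n.2 (fun _ => x) (q n.1 fun _ => x)) ?_) s
  filter_upwards [hp'.eventually_hasSum_pow_smul x, hq.eventually_hasSum_pow_smul x,
    hp'.eventually_summable_norm_pow_smul x, hq.eventually_summable_norm_pow_smul x] with t h1 h2 h3 h4
  change HasSum _ (fderiv 𝕜 f (t • x) (ξ (t • x)))
  convert ContinuousLinearMap.hasSum_antidiagonal_apply h1 h2 h3 h4 using 1
  funext s
  rw [Finset.smul_sum]
  refine Finset.sum_congr rfl fun n hn => ?_
  rw [map_smul, _root_.smul_apply, smul_smul, ← pow_add, HasAntidiagonal.mem_antidiagonal.1 hn]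

end TaylorSeries

/-! ### The formal action. -/

theorem vectorFieldDeriv_id (𝕜 : Type*) [RCLike 𝕜] {X : Type*} [NormedAddCommGroup X]
    [NormedSpace 𝕜 X] (ξ : X → X) : vectorFieldDeriv 𝕜 ξ (fun x : X => x) = ξ := by
  funext x
  simp [vectorFieldDeriv]

theorem mainTheorem8 {𝕜 : Type*} [RCLike 𝕜]
    {A : Type*} [NormableLieRing A] [NormableLieAlgebra 𝕜 A] [CompleteSpace A]
    {X : Type*} [NormedAddCommGroup X] [NormedSpace 𝕜 X] [CompleteSpace X]
    (U : Set X) (hU : IsOpen U) (h0 : (0 : X) ∈ U)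
    (ξ : A → X → X) (hξ : IsInfinitesimalRightLaw 𝕜 U ξ) :
    ∃ D : FormalAction 𝕜 A X, ∀ a : A,
      D a = taylorSeriesAtZero 𝕜 (vectorFieldDeriv 𝕜 (ξ a) fun x : X => x) ∧
      (D a).Represents (vectorFieldDeriv 𝕜 (ξ a) fun x : X => x) := by
  -- The inclusion has derivative the identity, so D_a is the Taylor series of ξ_a itself.
  simp only [vectorFieldDeriv_id]
  have hA : ∀ a, AnalyticAt 𝕜 (ξ a) 0 := fun a =>
    (hξ.analytic (a, 0) ⟨Set.mem_univ a, h0⟩).comp₂ analyticAt_const analyticAt_id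
  have hU0 : U ∈ 𝓝 (0 : X) := hU.mem_nhds h0
  refine ⟨{ toFun := fun a => taylorSeriesAtZero 𝕜 (ξ a), map_add' := ?_, map_smul' := ?_,
            map_lie' := ?_ }, fun a => ⟨rfl, (hA a).represents_taylorSeriesAtZero⟩⟩
  · intro a b
    rw [← taylorSeriesAtZero_add (hA a) (hA b)]
    exact taylorSeriesAtZero_congr <| by
      filter_upwards [hU0] with x hx using (hξ.isLinearMap x hx).map_add a b
  · intro c a
    rw [RingHom.id_apply, ← taylorSeriesAtZero_smul c (hA a)]
    exact taylorSeriesAtZero_congr <| by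
      filter_upwards [hU0] with x hx using (hξ.isLinearMap x hx).map_smul c a
  · intro a b
    rw [FormalSeries.lie_def, ← taylorSeriesAtZero_vectorFieldDeriv (hA a) (hA b),
      ← taylorSeriesAtZero_vectorFieldDeriv (hA b) (hA a),
      ← taylorSeriesAtZero_sub ((hA a).vectorFieldDeriv (hA b)) ((hA b).vectorFieldDeriv (hA a))]
    -- `VectorField.lieBracket` unfolds to the difference of the two derivatives along vector
    -- fields. The law gives the equality only on U, which suffices for germs at 0.
    exact taylorSeriesAtZero_congr <| by
      filter_upwards [hU0] with x hx using (hξ.lieBracket a b x hx).symm
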